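/- Let $\mathbb{B}$ be a complete Boolean algebra and let $\kappa \ge \omega$ and $\lambda$ be ordinals (for instance infinite cardinals). For ordinals $\mu,\nu$, say that $\mathbb{B}$ is $(\mu,\nu)$-distributive if $$\prod_{\alpha<\mu}\sum_{\beta<\nu}u_{\alpha,\beta}=\sum_{f:\mu\to\nu}\ \prod_{\alpha<\mu}u_{\alpha,f(\alpha)}$$ for all $\langle u_{\alpha,\beta}\in\mathbb{B}:\alpha<\mu,\ \beta<\nu\rangle$, and weakly $(\mu,\nu)$-distributive if $$\prod_{\alpha<\mu}\sum_{\beta<\nu}u_{\alpha,\beta}=\sum_{g:\mu\to\nu}\ \prod_{\alpha<\mu}\ \sum_{\beta<g(\alpha)}u_{\alpha,\beta}$$ for all such families. The tower number $\mathfrak{t}$ is the least length of a sequence $\langle S_\alpha : \alpha<\gamma\rangle$ of infinite subsets of $\omega$ such that $S_\beta\setminus S_\alpha$ is finite for all $\alpha<\beta<\gamma$, but no infinite $S\subseteq\omega$ has $S\setminus S_\alpha$ finite for all $\alpha<\gamma$. Theorem. Assume that $$1\Vdash_{\mathbb{B}}\ \check\kappa<\mathfrak{t}\qquad\text{and}\qquad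 1\Vdash_{\mathbb{B}}\ \check\lambda\le 2^{\omega},$$ where $\mathfrak{t}$ and $2^\omega$ are computed in the forcing extension and the inequalities are between ordinals there. If $\mathbb{B}$ is $(\omega,\lambda)$-distributive and weakly $(\lambda^\kappa,\kappa)$-distributive, where $\lambda^\kappa$ is the cardinal of the set of functions from $\kappa$ to $\lambda$ (in the ground model), then $\mathbb{B}$ is $(\lambda,2)$-distributive. -/

import Mathlib

universe u

/-! ### Distributivity laws -/

/-- `B` is `(μ, ν)`-distributive, for ordinals `μ` and `ν`. -/
def IsDistributiveBA (B : Type u) [CompleteBooleanAlgebra B] (μ ν : Ordinal.{u}) : Prop :=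
  ∀ a : μ.ToType → ν.ToType → B,
    ⨅ α, ⨆ β, a α β = ⨆ f : μ.ToType → ν.ToType, ⨅ α, a α (f α)

/-- `B` is weakly `(μ, ν)`-distributive, for ordinals `μ` and `ν`. -/
def IsWeaklyDistributiveBA (B : Type u) [CompleteBooleanAlgebra B] (μ ν : Ordinal.{u}) : Prop :=
  ∀ a : μ.ToType → ν.ToType → B,
    ⨅ α, ⨆ β, a α β = ⨆ g : μ.ToType → ν.ToType, ⨅ α, ⨆ β, ⨆ (_ : β < g α), a α β

/-! ### The Boolean-valued universe -/

/-- The class `V^B` of `B`-names: `mk ι x b` is the name with elements `x i` to degree `b i`. -/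
inductive BName (B : Type u) : Type (u + 1)
  | mk (ι : Type u) (elem : ι → BName B) (val : ι → B) : BName B

namespace BName

variable {B : Type u}

/-- The index type of a name. -/
def Idx : BName B → Type u
  | mk ι _ _ => ι

/-- The elements (the domain) of a name. -/
def elem : (x : BName B) → x.Idx → BName B
  | mk _ e _ => e

/-- The degrees to which the elements of its domain belong to a name. -/
def val : (x : BName B) → x.Idx → B
  | mk _ _ v => v

variable [CompleteBooleanAlgebra B]

/-- The Boolean value of `x = y`. -/
def eq : BName B → BName B → B
  | mk ι x a, mk ι' y b =>
    (⨅ i : ι, a i ⇨ ⨆ j : ι', b j ⊓ eq (x i) (y j)) ⊓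
      (⨅ j : ι', b j ⇨ ⨆ i : ι, a i ⊓ eq (x i) (y j))

/-- The Boolean value of `x ∈ y`. -/
def mem (x y : BName B) : B :=
  ⨆ j : y.Idx, y.val j ⊓ eq x (y.elem j)

/-- The canonical name of a set of the ground model. -/
def check : PSet.{u} → BName B
  | PSet.mk ι x => mk ι (fun i => check (x i)) (fun _ => ⊤)

/-- The canonical name of the ordinal `o`. -/
noncomputable def ordName (o : Ordinal.{u}) : BName B :=
  check o.toPSet

/-- The canonical name of `ω`; it denotes `ω` in the Boolean-valued universe. -/
noncomputable def omega : BName B :=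
  ordName Ordinal.omega0

/-- The unordered pair `{x, y}`. -/
def upair (x y : BName B) : BName B :=
  mk (ULift.{u} Bool) (fun i => cond i.down x y) (fun _ => ⊤)

/-- The (Kuratowski) ordered pair `⟨x, y⟩ = {{x}, {x, y}}`. -/
def opair (x y : BName B) : BName B :=
  upair (upair x x) (upair x y)

/-- The power set of `x`. -/
def powerset (x : BName B) : BName B :=
  mk (x.Idx → B) (fun χ => mk x.Idx x.elem (fun i => x.val i ⊓ χ i)) (fun _ => ⊤)

/-- The set `{z ∈ x : φ z}`. -/
def sep (x : BName B) (φ : BName B → B) : BName B :=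
  mk x.Idx x.elem (fun i => x.val i ⊓ φ (x.elem i))

/-! ### Boolean values of formulas of set theory -/

/-- `x ⊆ y` -/
def subset (x y : BName B) : B :=
  ⨅ z : BName B, mem z x ⇨ mem z y

/-- `x` is a transitive set. -/
def isTransitive (x : BName B) : B :=
  ⨅ y : BName B, mem y x ⇨ subset y x

/-- `x` is an ordinal: a transitive set of transitive sets. -/
def isOrdinal (x : BName B) : B :=
  isTransitive x ⊓ ⨅ y : BName B, mem y x ⇨ isTransitive y

/-- `f` is a function from `x` to `y`. -/
def isFunction (f x y : BName B) : B :=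
  (⨅ z : BName B, mem z f ⇨
      ⨆ a : BName B, ⨆ b : BName B, mem a x ⊓ mem b y ⊓ eq z (opair a b)) ⊓
    (⨅ a : BName B, mem a x ⇨ ⨆ b : BName B, mem (opair a b) f) ⊓
    (⨅ a : BName B, ⨅ b : BName B, ⨅ b' : BName B,
      mem (opair a b) f ⊓ mem (opair a b') f ⇨ eq b b')

/-- There is a bijection from `x` to `y`. -/
def equinumerous (x y : BName B) : B :=
  ⨆ f : BName B, isFunction f x y ⊓
    (⨅ a : BName B, ⨅ a' : BName B, ⨅ b : BName B,
      mem (opair a b) f ⊓ mem (opair a' b) f ⇨ eq a a') ⊓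
    (⨅ b : BName B, mem b y ⇨ ⨆ a : BName B, mem (opair a b) f)

/-- `c` is the cardinal `2^ω`: the least ordinal in bijection with the power set of `ω`. -/
noncomputable def isContinuum (c : BName B) : B :=
  isOrdinal c ⊓ equinumerous c (powerset omega) ⊓
    ⨅ d : BName B, mem d c ⇨ (equinumerous d (powerset omega))ᶜ

/-- `s`, a set of natural numbers, is infinite, that is, unbounded in `ω`. -/
noncomputable def isInfinite (s : BName B) : B :=
  ⨅ n : BName B, mem n omega ⇨ ⨆ m : BName B, mem m s ⊓ mem n m

/-- `[ω]^ω`, the set of infinite subsets of `ω`. -/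
noncomputable def infiniteSubsets : BName B :=
  sep (powerset omega) isInfinite

/-- `s ⊆* t` for sets `s`, `t` of natural numbers: `s \ t` is finite, that is, contained in
some natural number `n`. -/
noncomputable def almostSubset (s t : BName B) : B :=
  ⨆ n : BName B, mem n omega ⊓ ⨅ m : BName B, mem m s ⇨ mem m t ⊔ mem m n

/-- `f` is a sequence of length `γ` of elements of `[ω]^ω` that is decreasing with respect to `⊆*`
and such that no element of `[ω]^ω` is almost contained in all its terms. -/
noncomputable def isTower (f γ : BName B) : B :=
  isFunction f γ infiniteSubsets ⊓
    (⨅ α : BName B, ⨅ β : BName B, ⨅ s : BName B, ⨅ t : BName B,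
      mem α β ⊓ mem β γ ⊓ mem (opair α s) f ⊓ mem (opair β t) f ⇨ almostSubset t s) ⊓
    (⨆ p : BName B, mem p infiniteSubsets ⊓
      ⨅ α : BName B, ⨅ s : BName B, mem (opair α s) f ⇨ almostSubset p s)ᶜ

/-- `t` is the tower number: the least ordinal that is the length of a tower. -/
noncomputable def isTowerNumber (t : BName B) : B :=
  isOrdinal t ⊓ (⨆ f : BName B, isTower f t) ⊓
    ⨅ γ : BName B, mem γ t ⇨ (⨆ f : BName B, isTower f γ)ᶜ

/-- The Boolean value of `x < 𝔱`, for an ordinal `x`. -/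
noncomputable def ltTowerNumber (x : BName B) : B :=
  ⨆ t : BName B, isTowerNumber t ⊓ mem x t

/-- The Boolean value of `x ≤ 2^ω`, for an ordinal `x`. -/
noncomputable def leContinuum (x : BName B) : B :=
  ⨆ c : BName B, isContinuum c ⊓ subset x c

/-- `1 ⊩ φ`, where `φ` is given by its Boolean value. -/
def Forced (φ : B) : Prop :=
  φ = ⊤

end BName

/-! ### Forcing calculus: `Γ ≤ a` is read as "the condition `Γ` forces `a`" -/

namespace BooleanForcing

variable {B : Type*} [CompleteBooleanAlgebra B]

/-! The ground model is shown to contain, in turn, every real, every subset of κ and every subset of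
λ of the extension.

Reals: for λ ≥ 2, (ω,λ)-distributivity decides countably many Boolean values at once
(`noNewReals_of_isDistributiveBA`).

Subsets of κ: since κ < 𝔱 in the extension, ⊆*-decreasing sequences of length ≤ κ there have
infinite pseudo-intersections, and these are reals of the ground model. Build in the ground model a
tree of height κ of infinite subsets of ω: every node splits into two disjoint infinite halves, and
the node at level β of a branch is a pseudo-intersection of the halves chosen before. A subset of γ
≤ κ in the extension is a branch; inductively its proper initial segments are old, so it defines a
decreasing sequence. A pseudo-intersection of that sequence is old and lies below only this branch,
which can therefore be read off from it (`noNewSubsets_of_hasPseudoIntersections`).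

Subsets of λ: let A be a new one. Call a pair of a point and a truth value a literal. In the
extension, each old κ-sequence x of literals either holds throughout or fails at some index. There
are λ^κ such x, so weak distributivity yields an old g and a condition p forcing: if x holds before
g(x), it holds throughout. Starting from p, decide κ times a point of A that the current condition
leaves undecided. The branch of answers is a subset of κ, hence old, so some old branch stays
nonzero (`NoNewSubsets.exists_decided_ne_bot`). For its sequence x, the condition at step g(x)
already forces the literal with index g(x), whose point was chosen undecided: a contradiction
(`NoNewSubsets.iSup_iInf_lit_eq_top`). -/

theorem le_of_le_iSup {ι : Sort*} {f : ι → B} {Γ y : B} (h : Γ ≤ ⨆ i, f i)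
    (H : ∀ i, ∀ Δ ≤ Γ, Δ ≤ f i → Δ ≤ y) : Γ ≤ y := by
  rw [← inf_eq_left.2 h, inf_iSup_eq]
  exact iSup_le fun i => H i _ inf_le_left inf_le_right

theorem le_of_le_sup {Γ a b y : B} (h : Γ ≤ a ⊔ b) (ha : ∀ Δ ≤ Γ, Δ ≤ a → Δ ≤ y)
    (hb : ∀ Δ ≤ Γ, Δ ≤ b → Δ ≤ y) : Γ ≤ y := by
  rw [← inf_eq_left.2 h, inf_sup_left]
  exact sup_le (ha _ inf_le_left inf_le_right) (hb _ inf_le_left inf_le_right)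

theorem le_himp_of {Γ a b : B} (h : ∀ Δ ≤ Γ, Δ ≤ a → Δ ≤ b) : Γ ≤ a ⇨ b :=
  le_himp_iff.2 (h _ inf_le_left inf_le_right)

theorem le_of_le_himp {Γ a b : B} (h : Γ ≤ a ⇨ b) (ha : Γ ≤ a) : Γ ≤ b :=
  (le_inf h ha).trans himp_inf_le

theorem le_bot_of_le_compl {Γ a : B} (h : Γ ≤ aᶜ) (ha : Γ ≤ a) : Γ ≤ ⊥ :=
  (le_inf ha h).trans (inf_compl_self a).le

theorem le_compl_of {Γ a : B} (h : ∀ Δ ≤ Γ, Δ ≤ a → Δ ≤ ⊥) : Γ ≤ aᶜ := by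
  rw [← himp_bot]; exact le_himp_of h

end BooleanForcing

open BooleanForcing

/-! ### Equality and membership of names -/

namespace BName

variable {B : Type u} [CompleteBooleanAlgebra B] {Γ : B}

theorem eq_mk {ι ι' : Type u} (x : ι → BName B) (a : ι → B) (y : ι' → BName B) (b : ι' → B) :
    eq (mk ι x a) (mk ι' y b) = (⨅ i, a i ⇨ mem (x i) (mk ι' y b)) ⊓
      ⨅ j, b j ⇨ ⨆ i, a i ⊓ eq (x i) (y j) := by
  rw [eq]; rfl

theorem mem_mk {ι : Type u} (z : BName B) (x : ι → BName B) (a : ι → B) :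
    mem z (mk ι x a) = ⨆ i, a i ⊓ eq z (x i) := rfl

theorem eq_comm (x y : BName B) : eq x y = eq y x := by
  induction x generalizing y with
  | mk ι x a ih =>
    cases y with
    | mk ι' y b =>
      rw [eq, eq, inf_comm]
      simp only [ih]

theorem eq_mk' {ι ι' : Type u} (x : ι → BName B) (a : ι → B) (y : ι' → BName B) (b : ι' → B) :
    eq (mk ι x a) (mk ι' y b) = (⨅ i, a i ⇨ mem (x i) (mk ι' y b)) ⊓
      ⨅ j, b j ⇨ mem (y j) (mk ι x a) := by
  simp only [eq_mk, mem_mk, eq_comm (y _)]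

theorem eq_refl (x : BName B) : eq x x = ⊤ := by
  induction x with
  | mk ι x a ih =>
    have h : ∀ i, a i ≤ mem (x i) (mk ι x a) := fun i =>
      le_iSup_of_le (f := fun j => a j ⊓ eq (x i) (x j)) i (by rw [ih]; simp)
    rw [eq_mk', inf_idem, iInf_eq_top]
    exact fun i => himp_eq_top_iff.2 (h i)

theorem le_eq_symm {x y : BName B} (h : Γ ≤ eq x y) : Γ ≤ eq y x := by
  rwa [eq_comm]

theorem le_eq_refl (x : BName B) : Γ ≤ eq x x := by
  rw [eq_refl]; exact le_top

theorem le_mem_of_le_val {x : BName B} {i : x.Idx} (h : Γ ≤ x.val i) : Γ ≤ mem (x.elem i) x :=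
  le_iSup_of_le (f := fun j => x.val j ⊓ eq (x.elem i) (x.elem j)) i (le_inf h (le_eq_refl _))

theorem le_mem_mk {ι : Type u} {x : ι → BName B} {a : ι → B} {i : ι} (h : Γ ≤ a i) :
    Γ ≤ mem (x i) (mk ι x a) :=
  le_mem_of_le_val (x := mk ι x a) (i := i) h

/-- Elements of a name, up to equality, come from its domain. -/
theorem mem_elim {x y : BName B} {c : B} (h : Γ ≤ mem x y)
    (H : ∀ j, ∀ Δ ≤ Γ, Δ ≤ y.val j → Δ ≤ eq x (y.elem j) → Δ ≤ c) : Γ ≤ c :=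
  le_of_le_iSup h fun j Δ hΔ h => H j Δ hΔ (h.trans inf_le_left) (h.trans inf_le_right)

theorem mem_elem_of_eq {x y : BName B} (h : Γ ≤ eq x y) (i : x.Idx) (hi : Γ ≤ x.val i) :
    Γ ≤ mem (x.elem i) y := by
  cases x; cases y
  rw [eq_mk'] at h
  exact le_of_le_himp ((h.trans inf_le_left).trans (iInf_le _ i)) hi

theorem le_eq_ext {x y : BName B} (h : ∀ i, ∀ Δ ≤ Γ, Δ ≤ x.val i → Δ ≤ mem (x.elem i) y)
    (h' : ∀ i, ∀ Δ ≤ Γ, Δ ≤ y.val i → Δ ≤ mem (y.elem i) x) : Γ ≤ eq x y := by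
  cases x; cases y
  rw [eq_mk']
  exact le_inf (le_iInf fun i => le_himp_of (h i)) (le_iInf fun i => le_himp_of (h' i))

/-- Induction on `x` alone, with the other names and the condition free. Symmetry turns the backward
inclusion into the same instance of the induction hypothesis. -/
theorem le_eq_trans {x y z : BName B} (h : Γ ≤ eq x y) (h' : Γ ≤ eq y z) : Γ ≤ eq x z := by
  induction x generalizing y z Γ with
  | mk ι x a ih =>
    refine le_eq_ext (fun i Δ hΔ hi => ?_) (fun k Δ hΔ hk => ?_)
    · refine mem_elim (mem_elem_of_eq (hΔ.trans h) i hi) fun j Δ' hΔ' hj hij => ?_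
      refine mem_elim (mem_elem_of_eq ((hΔ'.trans hΔ).trans h') j hj) fun k Δ'' hΔ'' hk hjk => ?_
      exact le_iSup_of_le k (le_inf hk (ih i (hΔ''.trans hij) hjk))
    · refine mem_elim (mem_elem_of_eq (le_eq_symm (hΔ.trans h')) k hk) fun j Δ' hΔ' hj hkj => ?_
      refine mem_elim (mem_elem_of_eq (le_eq_symm ((hΔ'.trans hΔ).trans h)) j hj)
        fun i Δ'' hΔ'' hi hji => ?_
      exact le_iSup_of_le (f := fun i => a i ⊓ eq (z.elem k) (x i)) i
        (le_inf hi (le_eq_symm (ih i (le_eq_symm hji) (le_eq_symm (hΔ''.trans hkj)))))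

theorem le_mem_congr_left {x x' y : BName B} (h : Γ ≤ eq x x') (hm : Γ ≤ mem x y) :
    Γ ≤ mem x' y :=
  mem_elim hm fun j _ hΔ hj hxj =>
    le_iSup_of_le j (le_inf hj (le_eq_trans (le_eq_symm (hΔ.trans h)) hxj))

theorem le_mem_congr_right {x y y' : BName B} (h : Γ ≤ eq y y') (hm : Γ ≤ mem x y) :
    Γ ≤ mem x y' :=
  mem_elim hm fun j _ hΔ hj hxj =>
    le_mem_congr_left (le_eq_symm hxj) (mem_elem_of_eq (hΔ.trans h) j hj)

/-! ### Ordinals of the ground model -/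

theorem ordName_eq (o : Ordinal.{u}) :
    (ordName o : BName B) = mk o.ToType (fun a => ordName (a.toOrd : Ordinal)) fun _ => ⊤ := by
  rw [ordName, Ordinal.toPSet, check]; rfl

theorem le_mem_ordName {a b : Ordinal.{u}} (h : a < b) :
    Γ ≤ mem (ordName a) (ordName b : BName B) := by
  rw [ordName_eq b]
  have := le_mem_mk (Γ := Γ) (x := fun c : b.ToType => (ordName (c.toOrd : Ordinal) : BName B))
    (a := fun _ => ⊤) (i := Ordinal.ToType.mk ⟨a, h⟩) le_top
  simpa using this

theorem mem_ordName_elim {x : BName B} {o : Ordinal.{u}} {c : B} (h : Γ ≤ mem x (ordName o))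
    (H : ∀ a < o, ∀ Δ ≤ Γ, Δ ≤ eq x (ordName a) → Δ ≤ c) : Γ ≤ c := by
  rw [ordName_eq] at h
  exact mem_elim h fun j Δ hΔ _ hj => H _ j.toOrd.2 Δ hΔ hj

/-- Well-foundedness descends: `a ∈ a` gives `a = c` for some `c < a`, hence `c ∈ c`. -/
theorem ordName_mem_self (a : Ordinal.{u}) (h : Γ ≤ mem (ordName a) (ordName a : BName B)) :
    Γ ≤ ⊥ := by
  induction a using WellFoundedLT.induction generalizing Γ with
  | ind a ih =>
    exact mem_ordName_elim h fun c hc Δ _ hac =>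
      ih c hc (le_mem_congr_right hac (le_mem_ordName hc))

theorem ordName_ne {a b : Ordinal.{u}} (hab : a ≠ b)
    (h : Γ ≤ eq (ordName a) (ordName b : BName B)) : Γ ≤ ⊥ := by
  rcases lt_or_gt_of_ne hab with hab | hab
  · exact ordName_mem_self a (le_mem_congr_right (le_eq_symm h) (le_mem_ordName hab))
  · exact ordName_mem_self b (le_mem_congr_right h (le_mem_ordName hab))

theorem ordName_notMem {a b : Ordinal.{u}} (hab : b ≤ a)
    (h : Γ ≤ mem (ordName a) (ordName b : BName B)) : Γ ≤ ⊥ :=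
  mem_ordName_elim h fun _ hc _ _ hac => ordName_ne (hc.trans_le hab).ne' hac

theorem mem_omega_elim {x : BName B} {c : B} (h : Γ ≤ mem x omega)
    (H : ∀ n : ℕ, ∀ Δ ≤ Γ, Δ ≤ eq x (ordName n) → Δ ≤ c) : Γ ≤ c :=
  mem_ordName_elim h fun a ha Δ hΔ hxa => by
    obtain ⟨n, rfl⟩ := Ordinal.lt_omega0.1 ha
    exact H n Δ hΔ hxa

theorem le_mem_omega (n : ℕ) : Γ ≤ mem (ordName n) (omega : BName B) :=
  le_mem_ordName (Ordinal.natCast_lt_omega0 n)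

/-! ### Pairs -/

theorem le_mem_upair_left (x y : BName B) : Γ ≤ mem x (upair x y) :=
  le_mem_mk (x := fun i : ULift Bool => cond i.down x y) (a := fun _ => ⊤) (i := ⟨true⟩) le_top

theorem le_mem_upair_right (x y : BName B) : Γ ≤ mem y (upair x y) :=
  le_mem_mk (x := fun i : ULift Bool => cond i.down x y) (a := fun _ => ⊤) (i := ⟨false⟩) le_top

theorem mem_upair_elim {x y z : BName B} {c : B} (h : Γ ≤ mem z (upair x y))
    (hx : ∀ Δ ≤ Γ, Δ ≤ eq z x → Δ ≤ c) (hy : ∀ Δ ≤ Γ, Δ ≤ eq z y → Δ ≤ c) : Γ ≤ c :=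
  mem_elim h fun j Δ hΔ _ hj => by
    rcases j with ⟨_ | _⟩
    · exact hy Δ hΔ hj
    · exact hx Δ hΔ hj

theorem le_upair_congr {x x' y y' : BName B} (hx : Γ ≤ eq x x') (hy : Γ ≤ eq y y') :
    Γ ≤ eq (upair x y) (upair x' y') := by
  refine le_eq_ext ?_ ?_
  · rintro ⟨_ | _⟩ Δ hΔ -
    · exact le_mem_congr_left (le_eq_symm (hΔ.trans hy)) (le_mem_upair_right _ _)
    · exact le_mem_congr_left (le_eq_symm (hΔ.trans hx)) (le_mem_upair_left _ _)
  · rintro ⟨_ | _⟩ Δ hΔ -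
    · exact le_mem_congr_left (hΔ.trans hy) (le_mem_upair_right _ _)
    · exact le_mem_congr_left (hΔ.trans hx) (le_mem_upair_left _ _)

theorem le_opair_congr {x x' y y' : BName B} (hx : Γ ≤ eq x x') (hy : Γ ≤ eq y y') :
    Γ ≤ eq (opair x y) (opair x' y') :=
  le_upair_congr (le_upair_congr hx hx) (le_upair_congr hx hy)

theorem le_eq_of_singleton_eq_upair {x y z : BName B} (h : Γ ≤ eq (upair x x) (upair y z)) :
    Γ ≤ eq x y ∧ Γ ≤ eq x z :=
  ⟨mem_upair_elim (le_mem_congr_right (le_eq_symm h) (le_mem_upair_left y z))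
      (fun _ _ => le_eq_symm) fun _ _ => le_eq_symm,
    mem_upair_elim (le_mem_congr_right (le_eq_symm h) (le_mem_upair_right y z))
      (fun _ _ => le_eq_symm) fun _ _ => le_eq_symm⟩

theorem le_eq_of_upair_eq_upair {x y z : BName B} (h : Γ ≤ eq (upair x y) (upair x z)) :
    Γ ≤ eq y z := by
  refine mem_upair_elim (le_mem_congr_right h (le_mem_upair_right x y)) (fun Δ hΔ hyx => ?_)
    fun _ _ h => h
  refine mem_upair_elim (le_mem_congr_right (le_eq_symm (hΔ.trans h)) (le_mem_upair_right x z))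
    (fun Δ' hΔ' hzx => ?_) fun _ _ => le_eq_symm
  exact le_eq_trans (hΔ'.trans hyx) (le_eq_symm hzx)

theorem le_eq_of_opair_eq {x x' y y' : BName B} (h : Γ ≤ eq (opair x y) (opair x' y')) :
    Γ ≤ eq x x' ∧ Γ ≤ eq y y' := by
  have h1 : Γ ≤ eq x x' := by
    refine mem_upair_elim (le_mem_congr_right h (le_mem_upair_left _ _))
      (fun Δ _ h => (le_eq_of_singleton_eq_upair h).1)
      fun Δ _ h => (le_eq_of_singleton_eq_upair h).1
  refine ⟨h1, ?_⟩
  have h2 : Γ ≤ eq (opair x y') (opair x' y') := le_opair_congr h1 (le_eq_refl _)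
  exact le_eq_of_upair_eq_upair (le_eq_of_upair_eq_upair (le_eq_trans h (le_eq_symm h2)))

end BName

/-! ### Literals, and ground-model forms of the forcing hypotheses -/

namespace BooleanForcing

variable {B : Type*} [CompleteBooleanAlgebra B]

open Classical in
/-- `b` or its complement, according to whether `p` holds. -/
noncomputable def lit (b : B) (p : Prop) : B :=
  if p then b else bᶜ

theorem lit_of_true {b : B} {p : Prop} (h : p) : lit b p = b :=
  if_pos h

theorem lit_of_false {b : B} {p : Prop} (h : ¬p) : lit b p = bᶜ :=
  if_neg h

theorem lit_conflict {Γ b : B} {p q : Prop} (hp : Γ ≤ lit b p) (hq : Γ ≤ lit b q)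
    (h : ¬(p ↔ q)) : Γ ≤ ⊥ := by
  by_cases h1 : p <;> by_cases h2 : q <;> simp only [lit_of_true, lit_of_false, h1, h2,
    not_false_eq_true] at hp hq
  · exact absurd (iff_of_true h1 h2) h
  · exact le_bot_of_le_compl hq hp
  · exact le_bot_of_le_compl hp hq
  · exact absurd (iff_of_false h1 h2) h

/-- Every `B`-valued subset of `ℕ` belongs to the ground model. -/
def NoNewReals (B : Type*) [CompleteBooleanAlgebra B] : Prop :=
  ∀ b : ℕ → B, ⨆ s : Set ℕ, ⨅ n, lit (b n) (n ∈ s) = ⊤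

/-- Every `B`-valued `⊆*`-decreasing sequence of length `γ` of infinite subsets of `ℕ` has an
infinite pseudo-intersection in the ground model. -/
def HasPseudoIntersections (B : Type*) [CompleteBooleanAlgebra B] (γ : Ordinal.{u}) : Prop :=
  ∀ D : Ordinal.{u} → ℕ → B,
    (∀ α < γ, ∀ n, ⨆ m, ⨆ _ : n < m, D α m = ⊤) →
    (∀ β < γ, ∀ α < β, ⨆ k, ⨅ j, ⨅ _ : k ≤ j, D β j ⇨ D α j = ⊤) →
    ⨆ P : Set ℕ, ⨆ _ : P.Infinite, ⨅ α, ⨅ _ : α < γ, ⨆ k, ⨅ j, ⨅ _ : j ∈ P, ⨅ _ : k ≤ j, D α j = ⊤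

end BooleanForcing

/-! ### Reals and towers as names -/

namespace BName

variable {B : Type u} [CompleteBooleanAlgebra B] {Γ : B}

/-- The name of the set of natural numbers to which `n` belongs to degree `S n`. -/
noncomputable def setName (S : ℕ → B) : BName B :=
  mk (ULift.{u} ℕ) (fun n => ordName n.down) fun n => S n.down

theorem le_mem_setName {S : ℕ → B} {n : ℕ} (h : Γ ≤ S n) : Γ ≤ mem (ordName n) (setName S) :=
  le_mem_mk (x := fun n : ULift.{u} ℕ => (ordName n.down : BName B)) (a := fun n => S n.down)
    (i := ⟨n⟩) h

theorem mem_setName_elim {S : ℕ → B} {x : BName B} {c : B} (h : Γ ≤ mem x (setName S))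
    (H : ∀ n, ∀ Δ ≤ Γ, Δ ≤ S n → Δ ≤ eq x (ordName n) → Δ ≤ c) : Γ ≤ c :=
  mem_elim h fun j => H j.down

theorem le_of_mem_setName {S : ℕ → B} {n : ℕ} (h : Γ ≤ mem (ordName n) (setName S)) : Γ ≤ S n :=
  mem_setName_elim h fun m Δ _ hm hnm => by
    by_cases hne : n = m
    · rwa [hne]
    · exact (ordName_ne (by exact_mod_cast hne) hnm).trans bot_le

theorem le_isInfinite_congr {x y : BName B} (h : Γ ≤ eq x y) (hx : Γ ≤ isInfinite x) :
    Γ ≤ isInfinite y :=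
  le_iInf fun n => le_himp_of fun _ hΔ hn =>
    le_of_le_iSup (le_of_le_himp ((hΔ.trans hx).trans (iInf_le _ n)) hn) fun m _ hΔ' hm =>
      le_iSup_of_le m (le_inf (le_mem_congr_right (hΔ'.trans (hΔ.trans h)) (hm.trans inf_le_left))
        (hm.trans inf_le_right))

theorem le_isInfinite_setName {S : ℕ → B} (h : ∀ n, Γ ≤ ⨆ m, ⨆ _ : n < m, S m) :
    Γ ≤ isInfinite (setName S) :=
  le_iInf fun x => le_himp_of fun _ hΔ hx => mem_omega_elim hx fun n _ hΔ' hxn =>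
    le_of_le_iSup (hΔ'.trans (hΔ.trans (h n))) fun m _ hΔ'' hm =>
      le_of_le_iSup hm fun hnm _ hΘ hm => le_iSup_of_le (ordName m)
        (le_inf (le_mem_setName hm) (le_mem_congr_left (le_eq_symm ((hΘ.trans hΔ'').trans hxn))
          (le_mem_ordName (by exact_mod_cast hnm))))

theorem infiniteSubsets_eq : (infiniteSubsets : BName B) = mk (Ordinal.omega0.ToType → B)
    (fun χ => mk Ordinal.omega0.ToType (fun a => ordName (a.toOrd : Ordinal)) fun i => ⊤ ⊓ χ i)
    (fun χ => ⊤ ⊓ isInfinite (mk Ordinal.omega0.ToType (fun a => ordName (a.toOrd : Ordinal))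
      fun i => ⊤ ⊓ χ i)) := by
  have h : (powerset omega : BName B) = mk (Ordinal.omega0.ToType → B)
    (fun χ => mk Ordinal.omega0.ToType (fun a => ordName (a.toOrd : Ordinal)) fun i => ⊤ ⊓ χ i)
    fun _ => ⊤ := by rw [omega, ordName_eq]; rfl
  rw [infiniteSubsets, h]; rfl

theorem le_setName_mem_infiniteSubsets {S : ℕ → B} (h : ∀ n, Γ ≤ ⨆ m, ⨆ _ : n < m, S m) :
    Γ ≤ mem (setName S) infiniteSubsets := by
  rw [infiniteSubsets_eq]
  -- The domain of the power set consists of names over the domain of `omega`, so `setName S` must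
  -- be replaced by an equal name of that shape.
  let χ : Ordinal.omega0.{u}.ToType → B := fun a => mem (ordName (a.toOrd : Ordinal)) (setName S)
  have he : Γ ≤ eq (setName S) (mk Ordinal.omega0.ToType
      (fun a => ordName (a.toOrd : Ordinal)) fun i => ⊤ ⊓ χ i) := by
    refine le_eq_ext (fun n Δ _ hn => ?_) (fun a Δ _ ha => ha.trans inf_le_right)
    have := le_mem_mk (Γ := Δ)
      (x := fun a : Ordinal.omega0.{u}.ToType => (ordName (a.toOrd : Ordinal) : BName B))
      (a := fun a => ⊤ ⊓ χ a)
      (i := Ordinal.ToType.mk ⟨n.down, Ordinal.natCast_lt_omega0 n.down⟩)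
      (le_inf le_top (by
        change Δ ≤ mem _ _
        simpa using le_mem_setName hn))
    change Δ ≤ mem (ordName n.down) _
    simpa using this
  exact le_iSup_of_le χ
    (le_inf (le_inf le_top (le_isInfinite_congr he (le_isInfinite_setName h))) he)

theorem le_of_mem_infiniteSubsets {p : BName B} (h : Γ ≤ mem p infiniteSubsets) :
    Γ ≤ isInfinite p ∧ ∀ x, ∀ Δ ≤ Γ, Δ ≤ mem x p → Δ ≤ mem x omega := by
  rw [infiniteSubsets_eq] at h
  refine ⟨mem_elim h fun χ Δ _ hχ he => le_isInfinite_congr (le_eq_symm he)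
    (hχ.trans inf_le_right), fun x Δ hΔ hx => mem_elim (hΔ.trans h) fun χ Δ' hΔ' _ he =>
      mem_elim (le_mem_congr_right he (hΔ'.trans hx)) fun a Δ'' _ _ hxa =>
        le_mem_congr_left (le_eq_symm hxa) (le_mem_ordName a.toOrd.2)⟩

theorem le_of_isInfinite {p : BName B} (hp : ∀ x, ∀ Δ ≤ Γ, Δ ≤ mem x p → Δ ≤ mem x omega)
    (h : Γ ≤ isInfinite p) (n : ℕ) : Γ ≤ ⨆ m : ℕ, ⨆ _ : n < m, mem (ordName m) p := by
  refine le_of_le_iSup (le_of_le_himp (h.trans (iInf_le _ (ordName n))) (le_mem_omega n))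
    fun x Δ hΔ hx => ?_
  refine mem_omega_elim (hp x Δ hΔ (hx.trans inf_le_left)) fun m Δ' hΔ' hxm => ?_
  have hnm := le_mem_congr_right hxm (hΔ'.trans (hx.trans inf_le_right))
  by_cases hlt : n < m
  · exact le_iSup₂_of_le m hlt (le_mem_congr_left hxm (hΔ'.trans (hx.trans inf_le_left)))
  · exact (ordName_notMem (by exact_mod_cast not_lt.1 hlt) hnm).trans bot_le

theorem le_almostSubset_setName {S T : ℕ → B} (h : Γ ≤ ⨆ k, ⨅ j, ⨅ _ : k ≤ j, S j ⇨ T j) :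
    Γ ≤ almostSubset (setName S) (setName T) :=
  le_of_le_iSup h fun k Δ _ hk => le_iSup_of_le (ordName k) <| le_inf (le_mem_omega k) <|
    le_iInf fun x => le_himp_of fun Δ' hΔ' hx => mem_setName_elim hx fun j Δ'' hΔ'' hj hxj => by
      rcases le_or_gt k j with hkj | hjk
      · refine le_sup_of_le_left (le_mem_congr_left (le_eq_symm hxj) (le_mem_setName ?_))
        exact le_of_le_himp ((hΔ''.trans (hΔ'.trans hk)).trans (iInf₂_le j hkj)) hj
      · exact le_sup_of_le_right (le_mem_congr_left (le_eq_symm hxj)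
          (le_mem_ordName (by exact_mod_cast hjk)))

theorem le_of_almostSubset_setName {p : BName B} {T : ℕ → B}
    (h : Γ ≤ almostSubset p (setName T)) :
    Γ ≤ ⨆ k : ℕ, ⨅ j : ℕ, ⨅ _ : k ≤ j, mem (ordName j) p ⇨ T j :=
  le_of_le_iSup h fun n Δ _ hn => mem_omega_elim (hn.trans inf_le_left) fun k Δ' hΔ' hnk =>
    le_iSup_of_le k <| le_iInf₂ fun j hkj => le_himp_of fun Δ'' hΔ'' hj => by
      refine le_of_le_sup (le_of_le_himp ((hΔ''.trans (hΔ'.trans (hn.trans inf_le_right))).trans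
        (iInf_le _ (ordName j))) hj) (fun _ _ => le_of_mem_setName) fun Θ hΘ hjn => ?_
      exact (ordName_notMem (by exact_mod_cast hkj)
        (le_mem_congr_right (hΘ.trans (hΔ''.trans hnk)) hjn)).trans bot_le

theorem le_almostSubset_congr {s s' t t' : BName B} (hs : Γ ≤ eq s s') (ht : Γ ≤ eq t t')
    (h : Γ ≤ almostSubset s t) : Γ ≤ almostSubset s' t' :=
  le_of_le_iSup h fun n Δ hΔ hn => le_iSup_of_le n <| le_inf (hn.trans inf_le_left) <|
    le_iInf fun m => le_himp_of fun Δ' hΔ' hm => by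
      refine le_of_le_sup (le_of_le_himp ((hΔ'.trans (hn.trans inf_le_right)).trans (iInf_le _ m))
        (le_mem_congr_right (le_eq_symm (hΔ'.trans (hΔ.trans hs))) hm))
        (fun Θ hΘ h => le_sup_of_le_left ?_) fun Θ hΘ h => le_sup_of_le_right h
      exact le_mem_congr_right (hΘ.trans (hΔ'.trans (hΔ.trans ht))) h

/-- The name of the sequence of length `γ` with terms `setName (D α)`. -/
noncomputable def seqName (γ : Ordinal.{u}) (D : Ordinal.{u} → ℕ → B) : BName B :=
  mk γ.ToType (fun a => opair (ordName (a.toOrd : Ordinal)) (setName (D a.toOrd))) fun _ => ⊤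

section Sequence

variable {γ : Ordinal.{u}} {D : Ordinal.{u} → ℕ → B}

theorem le_mem_seqName {α : Ordinal.{u}} (h : α < γ) :
    Γ ≤ mem (opair (ordName α) (setName (D α))) (seqName γ D) := by
  have := le_mem_mk (Γ := Γ) (i := Ordinal.ToType.mk ⟨α, h⟩) (a := fun _ => ⊤)
    (x := fun a : γ.ToType => opair (ordName (a.toOrd : Ordinal)) (setName (D a.toOrd))) le_top
  simpa [seqName] using this

theorem mem_seqName_elim {x : BName B} {c : B} (h : Γ ≤ mem x (seqName γ D))
    (H : ∀ α < γ, ∀ Δ ≤ Γ, Δ ≤ eq x (opair (ordName α) (setName (D α))) → Δ ≤ c) : Γ ≤ c :=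
  mem_elim h fun j Δ hΔ _ => H _ j.toOrd.2 Δ hΔ

theorem opair_mem_seqName_elim {x y : BName B} {c : B} (h : Γ ≤ mem (opair x y) (seqName γ D))
    (H : ∀ α < γ, ∀ Δ ≤ Γ, Δ ≤ eq x (ordName α) → Δ ≤ eq y (setName (D α)) → Δ ≤ c) : Γ ≤ c :=
  mem_seqName_elim h fun α hα Δ hΔ he =>
    H α hα Δ hΔ (le_eq_of_opair_eq he).1 (le_eq_of_opair_eq he).2

theorem le_isFunction_seqName (hD : ∀ α < γ, ∀ n, ⨆ m, ⨆ _ : n < m, D α m = ⊤) :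
    Γ ≤ isFunction (seqName γ D) (ordName γ) infiniteSubsets := by
  refine le_inf (le_inf ?_ ?_) ?_
  · refine le_iInf fun z => le_himp_of fun Δ _ hz => mem_seqName_elim hz fun α hα Δ' _ he => ?_
    refine le_iSup₂_of_le (ordName α) (setName (D α)) (le_inf (le_inf (le_mem_ordName hα) ?_) he)
    exact le_setName_mem_infiniteSubsets fun n => (hD α hα n).symm ▸ le_top
  · refine le_iInf fun a => le_himp_of fun Δ _ ha => mem_ordName_elim ha fun α hα Δ' _ he => ?_
    exact le_iSup_of_le (setName (D α)) (le_mem_congr_left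
      (le_opair_congr (le_eq_symm he) (le_eq_refl _)) (le_mem_seqName hα))
  · refine le_iInf fun a => le_iInf fun b => le_iInf fun b' => le_himp_of fun Δ _ h => ?_
    refine opair_mem_seqName_elim (h.trans inf_le_left) fun α _ Δ' hΔ' haα hb => ?_
    refine opair_mem_seqName_elim (hΔ'.trans (h.trans inf_le_right)) fun β _ Δ'' hΔ'' haβ hb' => ?_
    by_cases hαβ : α = β
    · subst hαβ
      exact le_eq_trans (hΔ''.trans hb) (le_eq_symm hb')
    · exact (ordName_ne hαβ (le_eq_trans (le_eq_symm (hΔ''.trans haα)) haβ)).trans bot_le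

theorem le_decreasing_seqName
    (hD : ∀ β < γ, ∀ α < β, ⨆ k, ⨅ j, ⨅ _ : k ≤ j, D β j ⇨ D α j = ⊤) :
    Γ ≤ ⨅ α : BName B, ⨅ β : BName B, ⨅ s : BName B, ⨅ t : BName B,
      mem α β ⊓ mem β (ordName γ) ⊓ mem (opair α s) (seqName γ D) ⊓
        mem (opair β t) (seqName γ D) ⇨ almostSubset t s := by
  refine le_iInf fun x => le_iInf fun y => le_iInf fun s => le_iInf fun t =>
    le_himp_of fun Δ _ h => ?_
  refine opair_mem_seqName_elim (h.trans (inf_le_left.trans inf_le_right))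
    fun α hα Δ' hΔ' hx hs => ?_
  refine opair_mem_seqName_elim (hΔ'.trans (h.trans inf_le_right)) fun β hβ Δ'' hΔ'' hy ht => ?_
  have hm : Δ'' ≤ mem (ordName α) (ordName β) := le_mem_congr_left (hΔ''.trans hx)
    (le_mem_congr_right hy ((hΔ''.trans hΔ').trans
      (h.trans (inf_le_left.trans (inf_le_left.trans inf_le_left)))))
  rcases lt_or_ge α β with hαβ | hβα
  · refine le_almostSubset_congr (le_eq_symm ht) (le_eq_symm (hΔ''.trans hs))
      (le_almostSubset_setName ?_)
    exact (hD β hβ α hαβ).symm ▸ le_top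
  · exact (ordName_notMem hβα hm).trans bot_le

end Sequence

/-- The tower number is transitive and contains `κ`, so it contains `γ`; its minimality excludes
towers of length `γ`. -/
theorem isTower_eq_bot {κ γ : Ordinal.{u}} (hκ : Forced (ltTowerNumber (ordName κ : BName B)))
    (hγ : γ ≤ κ) (f : BName B) : isTower f (ordName γ) = ⊥ := by
  refine le_bot_iff.1 (le_of_le_iSup (le_top.trans (Eq.ge hκ)) fun t Δ hΔ ht => ?_)
  have ht1 := ht.trans inf_le_left
  have hm : Δ ≤ mem (ordName γ) t := by
    rcases hγ.eq_or_lt with rfl | hlt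
    · exact ht.trans inf_le_right
    · have htr : Δ ≤ isTransitive t :=
        ht1.trans (inf_le_left.trans (inf_le_left.trans inf_le_left))
      have hsub := le_of_le_himp (htr.trans (iInf_le _ (ordName κ))) (ht.trans inf_le_right)
      exact le_of_le_himp (hsub.trans (iInf_le _ (ordName γ))) (le_mem_ordName hlt)
  exact le_bot_of_le_compl (le_of_le_himp ((ht1.trans inf_le_right).trans (iInf_le _ _)) hm)
    (hΔ.trans (le_iSup (fun f => isTower f (ordName γ)) f))

/-- Sequences shorter than the tower number of the extension have pseudo-intersections. -/
theorem hasPseudoIntersections_of_ltTowerNumber {κ γ : Ordinal.{u}} (hB : NoNewReals B)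
    (hκ : Forced (ltTowerNumber (ordName κ : BName B))) (hγ : γ ≤ κ) :
    HasPseudoIntersections B γ := by
  intro D hinf hdec
  have htop : (⊤ : B) ≤ ⨆ p : BName B, mem p infiniteSubsets ⊓
      ⨅ α : BName B, ⨅ s : BName B, mem (opair α s) (seqName γ D) ⇨ almostSubset p s := by
    -- The sequence satisfies the first two clauses of being a tower with value `⊤`, so the third,
    -- having no pseudo-intersection, must have value `⊥`.
    have h := isTower_eq_bot hκ hγ (seqName γ D)
    rw [← compl_compl (⨆ p : BName B, _)]
    refine le_compl_of fun Δ _ hΔ => h ▸ ?_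
    exact le_inf (le_inf (le_isFunction_seqName hinf) (le_decreasing_seqName hdec)) hΔ
  refine top_le_iff.1 (le_of_le_iSup htop fun p Δ _ hp => ?_)
  obtain ⟨hpinf, hpω⟩ := le_of_mem_infiniteSubsets (hp.trans inf_le_left)
  refine le_of_le_iSup (le_top.trans (hB fun n => mem (ordName n) p).ge) fun P Δ' hΔ' hP => ?_
  by_cases hPinf : P.Infinite
  · refine le_iSup₂_of_le P hPinf (le_iInf₂ fun α hα => ?_)
    have himp : Δ' ≤ mem (opair (ordName α) (setName (D α))) (seqName γ D) ⇨
        almostSubset p (setName (D α)) :=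
      (hΔ'.trans (hp.trans inf_le_right)).trans
        (iInf_le_of_le (ordName α) (iInf_le _ (setName (D α))))
    have hsub := le_of_le_himp himp (le_mem_seqName hα)
    refine le_of_le_iSup (le_of_almostSubset_setName hsub) fun k Δ'' hΔ'' hk => ?_
    refine le_iSup_of_le k (le_iInf fun j => le_iInf fun hj => le_iInf fun hkj => ?_)
    refine le_of_le_himp (hk.trans (iInf₂_le j hkj)) ?_
    have := hΔ''.trans (hP.trans (iInf_le _ j))
    rwa [lit_of_true hj] at this
  -- A finite `P` cannot agree with `p`, which has an element beyond any bound of `P`.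
  · obtain ⟨n, hn⟩ := (Set.not_infinite.1 hPinf).bddAbove
    refine le_of_le_iSup (hΔ'.trans (le_of_isInfinite hpω hpinf n)) fun m Δ'' hΔ'' hm => ?_
    refine le_of_le_iSup hm fun hnm Θ hΘ hm => ?_
    have := (hΘ.trans hΔ'').trans (hP.trans (iInf_le _ m))
    rw [lit_of_false fun h => absurd (hn h) (not_le.2 hnm)] at this
    exact (le_bot_of_le_compl this hm).trans bot_le

end BName

namespace BooleanForcing

/-! ### A tree of infinite sets of natural numbers -/

/-- `P ⊆* Q` for sets of natural numbers. -/
def AlmostSubset (P Q : Set ℕ) : Prop :=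
  ∃ k, ∀ j, k ≤ j → j ∈ P → j ∈ Q

theorem AlmostSubset.trans {P Q R : Set ℕ} (h : AlmostSubset P Q) (h' : AlmostSubset Q R) :
    AlmostSubset P R := by
  obtain ⟨k, hk⟩ := h
  obtain ⟨l, hl⟩ := h'
  exact ⟨max k l, fun j hj hP => hl j (le_of_max_le_right hj) (hk j (le_of_max_le_left hj) hP)⟩

theorem AlmostSubset.of_subset {P Q : Set ℕ} (h : P ⊆ Q) : AlmostSubset P Q :=
  ⟨0, fun _ _ hj => h hj⟩

theorem exists_infinite_split {X : Set ℕ} (hX : X.Infinite) :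
    ∃ Y ⊆ X, Y.Infinite ∧ (X \ Y).Infinite := by
  obtain ⟨Y, Z, rfl, hd, hc⟩ := hX.exists_union_disjoint_cardinal_eq_of_infinite
  have hYZ : Y.Infinite ↔ Z.Infinite := by
    rw [← Set.infinite_coe_iff, ← Set.infinite_coe_iff, Cardinal.infinite_iff,
      Cardinal.infinite_iff, hc]
  have hY : Y.Infinite := (Set.infinite_union.1 hX).elim id hYZ.2
  refine ⟨Y, Set.subset_union_left, hY, ?_⟩
  rw [Set.union_sdiff_cancel_left hd.le_bot]
  exact hYZ.1 hY

open Classical in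
/-- The two halves of an infinite set, according to whether `p` holds. -/
noncomputable def half (X : Set ℕ) (p : Prop) : Set ℕ :=
  if h : X.Infinite then if p then (exists_infinite_split h).choose
    else X \ (exists_infinite_split h).choose else X

theorem half_subset (X : Set ℕ) (p : Prop) : half X p ⊆ X := by
  unfold half
  split_ifs with h
  · exact (exists_infinite_split h).choose_spec.1
  · exact Set.sdiff_subset
  · exact subset_rfl

theorem half_infinite {X : Set ℕ} (h : X.Infinite) (p : Prop) : (half X p).Infinite := by
  unfold half
  rw [dif_pos h]
  split_ifs
  · exact (exists_infinite_split h).choose_spec.2.1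
  · exact (exists_infinite_split h).choose_spec.2.2

theorem half_disjoint {X : Set ℕ} (h : X.Infinite) {p q : Prop} (hpq : ¬(p ↔ q)) :
    Disjoint (half X p) (half X q) := by
  unfold half
  rw [dif_pos h, dif_pos h]
  by_cases hp : p <;> by_cases hq : q
  · exact absurd (iff_of_true hp hq) hpq
  · rw [if_pos hp, if_neg hq]; exact Set.disjoint_sdiff_right
  · rw [if_neg hp, if_pos hq]; exact Set.disjoint_sdiff_left
  · exact absurd (iff_of_false hp hq) hpq

open Classical in
/-- An infinite pseudo-intersection of `F`, if there is one. -/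
noncomputable def pseudoIntersection (F : Set (Set ℕ)) : Set ℕ :=
  if h : ∃ P : Set ℕ, P.Infinite ∧ ∀ X ∈ F, AlmostSubset P X then h.choose else Set.univ

theorem pseudoIntersection_spec {F : Set (Set ℕ)}
    (h : ∃ P : Set ℕ, P.Infinite ∧ ∀ X ∈ F, AlmostSubset P X) :
    (pseudoIntersection F).Infinite ∧ ∀ X ∈ F, AlmostSubset (pseudoIntersection F) X := by
  unfold pseudoIntersection
  rw [dif_pos h]
  exact h.choose_spec

/-- The node at level `β` below the branch `s` of a tree of infinite subsets of `ℕ`. -/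
noncomputable def towerTree (s : Set Ordinal.{u}) (β : Ordinal.{u}) : Set ℕ :=
  pseudoIntersection (Set.range fun γ : Set.Iio β => half (towerTree s γ.1) (γ.1 ∈ s))
termination_by β
decreasing_by exact γ.2

theorem towerTree_congr {s t : Set Ordinal.{u}} (β : Ordinal.{u})
    (h : ∀ δ < β, (δ ∈ s ↔ δ ∈ t)) : towerTree s β = towerTree t β := by
  induction β using WellFoundedLT.induction with
  | ind β ih =>
    rw [towerTree, towerTree]
    congr 2
    funext γ
    rw [ih γ.1 γ.2 fun δ hδ => h δ (hδ.trans γ.2), propext (h γ.1 γ.2)]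

/-- The node at `β` depends on `s` below `β`, but the chosen half also on whether `β ∈ s`; hence the
bound `β + 1`. -/
theorem half_towerTree_congr {s t : Set Ordinal.{u}} {β : Ordinal.{u}}
    (h : ∀ δ < β + 1, (δ ∈ s ↔ δ ∈ t)) :
    half (towerTree s β) (β ∈ s) = half (towerTree t β) (β ∈ t) := by
  rw [towerTree_congr β fun δ hδ => h δ (hδ.trans (Order.lt_add_one_iff.2 le_rfl)),
    propext (h β (Order.lt_add_one_iff.2 le_rfl))]

variable {B : Type*} [CompleteBooleanAlgebra B]

/-- The ground model inherits pseudo-intersections from the extension. -/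
theorem HasPseudoIntersections.exists_infinite [Nontrivial B] {γ : Ordinal.{u}}
    (h : HasPseudoIntersections B γ) {D : Ordinal.{u} → Set ℕ} (hD : ∀ α < γ, (D α).Infinite)
    (hdec : ∀ β < γ, ∀ α < β, AlmostSubset (D β) (D α)) :
    ∃ P : Set ℕ, P.Infinite ∧ ∀ α < γ, AlmostSubset P (D α) := by
  have key := h (fun α j => lit ⊤ (j ∈ D α)) (fun α hα n => ?_) fun β hβ α hα => ?_
  · by_contra hno
    refine (bot_lt_top (α := B)).not_ge (le_of_le_iSup key.ge fun P Δ _ hP =>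
      le_of_le_iSup hP fun hPinf Δ' hΔ' hP => ?_)
    have hex : ∃ α < γ, ¬AlmostSubset P (D α) := by
      by_contra hall
      exact hno ⟨P, hPinf, fun α hα => not_not.1 fun hn => hall ⟨α, hα, hn⟩⟩
    obtain ⟨α, hα, hn⟩ := hex
    refine le_of_le_iSup (hP.trans (iInf₂_le α hα)) fun k Θ _ hk => ?_
    unfold AlmostSubset at hn
    push Not at hn
    obtain ⟨j, hkj, hjP, hjD⟩ := hn k
    have := hk.trans ((iInf_le _ j).trans ((iInf_le _ hjP).trans (iInf_le _ hkj)))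
    rw [lit_of_false hjD] at this
    exact this.trans (by simp)
  · obtain ⟨m, hm, hnm⟩ := (hD α hα).exists_gt n
    exact top_le_iff.1 (le_iSup₂_of_le m hnm (lit_of_true hm).ge)
  · obtain ⟨k, hk⟩ := hdec β hβ α hα
    refine top_le_iff.1 (le_iSup_of_le k (le_iInf₂ fun j hj => le_himp_of fun Δ _ hΔ => ?_))
    by_cases hjβ : j ∈ D β
    · simp [lit_of_true (hk j hj hjβ)]
    · rw [lit_of_false hjβ] at hΔ
      exact (hΔ.trans (by simp)).trans bot_le

/-- Along `s` the chosen halves are ⊆*-decreasing, as each lies in its node and each node is almost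
contained in the earlier halves. So a pseudo-intersection exists and the default value `Set.univ` is
never taken up to level `κ`. -/
theorem towerTree_spec [Nontrivial B] {κ : Ordinal.{u}}
    (h : ∀ γ ≤ κ, HasPseudoIntersections B γ) (s : Set Ordinal.{u}) (β : Ordinal.{u})
    (hβ : β ≤ κ) : (towerTree s β).Infinite ∧
      ∀ γ < β, AlmostSubset (towerTree s β) (half (towerTree s γ) (γ ∈ s)) := by
  induction β using WellFoundedLT.induction with
  | ind β ih =>
    obtain ⟨P, hP, hPD⟩ := (h β hβ).exists_infinite
      (D := fun γ => half (towerTree s γ) (γ ∈ s))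
      (fun γ hγ => half_infinite (ih γ hγ (hγ.le.trans hβ)).1 _)
      fun γ hγ δ hδ => (AlmostSubset.of_subset (half_subset _ _)).trans
        ((ih γ hγ (hγ.le.trans hβ)).2 δ hδ)
    have := pseudoIntersection_spec
      (F := Set.range fun γ : Set.Iio β => half (towerTree s γ.1) (γ.1 ∈ s))
      ⟨P, hP, by rintro _ ⟨γ, rfl⟩; exact hPD γ.1 γ.2⟩
    rw [towerTree]
    exact ⟨this.1, fun γ hγ => this.2 _ ⟨⟨γ, hγ⟩, rfl⟩⟩

/-- An infinite set lies below at most one node of each level. -/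
theorem branch_unique [Nontrivial B] {κ : Ordinal.{u}}
    (h : ∀ γ ≤ κ, HasPseudoIntersections B γ) {s t : Set Ordinal.{u}} {β : Ordinal.{u}}
    (hβ : β ≤ κ) {P : Set ℕ} (hP : P.Infinite)
    (hs : AlmostSubset P (half (towerTree s β) (β ∈ s)))
    (ht : AlmostSubset P (half (towerTree t β) (β ∈ t))) :
    ∀ δ ≤ β, (δ ∈ s ↔ δ ∈ t) := by
  have below : ∀ s : Set Ordinal.{u}, AlmostSubset P (half (towerTree s β) (β ∈ s)) →
      ∀ δ ≤ β, AlmostSubset P (half (towerTree s δ) (δ ∈ s)) := by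
    intro s hs δ hδ
    rcases hδ.eq_or_lt with rfl | hlt
    · exact hs
    · exact (hs.trans (.of_subset (half_subset _ _))).trans ((towerTree_spec h s β hβ).2 δ hlt)
  intro δ
  induction δ using WellFoundedLT.induction with
  | ind δ ih =>
    intro hδ
    by_contra hne
    -- At the least disagreement the nodes still coincide, but opposite halves are chosen; these are
    -- disjoint, while `P` is almost contained in both.
    have heq : towerTree s δ = towerTree t δ :=
      towerTree_congr δ fun ε hε => ih ε hε (hε.le.trans hδ)
    obtain ⟨k, hk⟩ := below s hs δ hδ
    obtain ⟨l, hl⟩ := below t ht δ hδ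
    obtain ⟨j, hj, hlt⟩ := hP.exists_gt (max k l)
    have hk := hk j ((le_max_left k l).trans hlt.le) hj
    have hl := hl j ((le_max_right k l).trans hlt.le) hj
    rw [heq] at hk
    exact Set.disjoint_left.1
      (half_disjoint (towerTree_spec h t δ (hδ.trans hβ)).1 hne) hk hl

/-! ### No new subsets of ordinals below the tower number -/

/-- Every `B`-valued subset of `γ` belongs to the ground model. -/
def NoNewSubsets (B : Type*) [CompleteBooleanAlgebra B] (γ : Ordinal.{u}) : Prop :=
  ∀ b : Ordinal.{u} → B, ⨆ s : Set Ordinal.{u}, ⨅ δ, ⨅ _ : δ < γ, lit (b δ) (δ ∈ s) = ⊤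

theorem NoNewSubsets.add_one {β : Ordinal.{u}} (h : NoNewSubsets B β) :
    NoNewSubsets B (β + 1) := by
  intro b
  refine top_le_iff.1 (le_of_le_iSup (h b).ge fun s Δ _ hs => ?_)
  have key : ∀ p : Prop, ∀ Θ ≤ Δ, Θ ≤ lit (b β) p →
      Θ ≤ ⨆ s : Set Ordinal.{u}, ⨅ δ, ⨅ _ : δ < β + 1, lit (b δ) (δ ∈ s) := by
    intro p Θ hΘ hp
    refine le_iSup_of_le {δ | δ < β ∧ δ ∈ s ∨ δ = β ∧ p} (le_iInf₂ fun δ hδ => ?_)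
    rcases (Order.lt_add_one_iff.1 hδ).eq_or_lt with rfl | hlt
    · simpa using hp
    · simpa [hlt, hlt.ne] using hΘ.trans (hs.trans (iInf₂_le δ hlt))
  have htop : Δ ≤ b β ⊔ (b β)ᶜ := by simp
  refine le_of_le_sup htop (fun Θ hΘ hb => key True Θ hΘ ?_) fun Θ hΘ hb => key False Θ hΘ ?_
  · rwa [lit_of_true trivial]
  · rwa [lit_of_false not_false]

/-- The `B`-valued set `b` is a branch of the tree whose proper initial segments are old by
induction; an old pseudo-intersection of the halves along it determines it. -/
theorem noNewSubsets_of_hasPseudoIntersections [Nontrivial B] {κ : Ordinal.{u}}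
    (h : ∀ γ ≤ κ, HasPseudoIntersections B γ) (γ : Ordinal.{u}) (hγ : γ ≤ κ) :
    NoNewSubsets B γ := by
  induction γ using WellFoundedLT.induction with
  | ind γ ih =>
    intro b
    -- The value of "`b` and `s` agree up to and including `β`". Under it, `D β` below is the half
    -- `T s β`; this is what `hD` and `hD'` say.
    let e : Set Ordinal.{u} → Ordinal.{u} → B := fun s β =>
      ⨅ δ, ⨅ _ : δ < β + 1, lit (b δ) (δ ∈ s)
    have he : ∀ β < γ, ⨆ s, e s β = ⊤ := fun β hβ =>
      (ih β hβ (hβ.le.trans hγ)).add_one b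
    have e_mono : ∀ s α β, α ≤ β → e s β ≤ e s α := fun s α β hαβ =>
      le_iInf₂ fun δ hδ => iInf₂_le δ 
      (Order.lt_add_one_iff.2 ((Order.lt_add_one_iff.1 hδ).trans hαβ))
    let T : Set Ordinal.{u} → Ordinal.{u} → Set ℕ := fun s β => half (towerTree s β) (β ∈ s)
    let D : Ordinal.{u} → ℕ → B := fun β n => ⨆ s, ⨆ _ : n ∈ T s β, e s β
    have hD : ∀ s β n Δ, Δ ≤ e s β → n ∈ T s β → Δ ≤ D β n := fun s β n Δ hΔ hn =>
      le_iSup₂_of_le s hn hΔ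
    have hD' : ∀ s β n Δ, Δ ≤ e s β → n ∉ T s β → Δ ≤ D β n → Δ ≤ ⊥ := by
      intro s β n Δ hΔ hn hDn
      refine le_of_le_iSup hDn fun t Δ' hΔ' ht => le_of_le_iSup ht fun hnt Θ hΘ ht => ?_
      by_cases hst : ∀ δ < β + 1, (δ ∈ s ↔ δ ∈ t)
      · exact absurd (show n ∈ half _ _ from half_towerTree_congr hst ▸ hnt) hn
      · push Not at hst
        obtain ⟨δ, hδ, hne⟩ := hst
        refine lit_conflict (((hΘ.trans hΔ').trans hΔ).trans (iInf₂_le δ hδ))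
          (ht.trans (iInf₂_le δ hδ)) ?_
        tauto
    have htop := h γ hγ D ?_ ?_
    · refine top_le_iff.1 (le_of_le_iSup htop.ge fun P Δ _ hP =>
        le_of_le_iSup hP fun hPinf Δ' hΔ' hP => ?_)
      have hbranch : ∀ β < γ, ∀ s, ∀ Θ ≤ Δ', Θ ≤ e s β → ¬AlmostSubset P (T s β) → Θ ≤ ⊥ := by
        intro β hβ s Θ hΘ hs hno
        refine le_of_le_iSup (hΘ.trans (hP.trans (iInf₂_le β hβ))) fun k Θ' hΘ' hk => ?_
        unfold AlmostSubset at hno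
        push Not at hno
        obtain ⟨j, hkj, hjP, hjT⟩ := hno k
        exact hD' s β j Θ' (hΘ'.trans hs) hjT
          (hk.trans ((iInf_le _ j).trans ((iInf_le _ hjP).trans (iInf_le _ hkj))))
      -- Decoding `b` from `P`: by `branch_unique`, all `s` with `P` almost contained in `T s β`
      -- agree at `β`.
      refine le_iSup_of_le {β | ∃ s, AlmostSubset P (T s β) ∧ β ∈ s} (le_iInf₂ fun β hβ => ?_)
      refine le_of_le_iSup (le_top.trans (he β hβ).ge) fun s Θ hΘ hs => ?_
      by_cases hPs : AlmostSubset P (T s β)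
      · have hiff : (β ∈ {β | ∃ s, AlmostSubset P (T s β) ∧ β ∈ s}) ↔ β ∈ s :=
          ⟨fun ⟨t, ht, htβ⟩ =>
            (branch_unique h (hβ.le.trans hγ) hPinf ht hPs β le_rfl).1 htβ,
            fun hs => ⟨s, hPs, hs⟩⟩
        rw [propext hiff]
        exact hs.trans (iInf₂_le β (Order.lt_add_one_iff.2 le_rfl))
      · exact (hbranch β hβ s Θ hΘ hs hPs).trans bot_le
    · intro β hβ n
      refine top_le_iff.1 (le_of_le_iSup (he β hβ).ge fun s Δ _ hs => ?_)
      obtain ⟨m, hm, hnm⟩ := (half_infinite (towerTree_spec h s β (hβ.le.trans hγ)).1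
        (β ∈ s)).exists_gt n
      exact le_iSup₂_of_le m hnm (hD s β m Δ hs hm)
    · intro β hβ α hα
      refine top_le_iff.1 (le_of_le_iSup (he β hβ).ge fun s Δ _ hs => ?_)
      obtain ⟨k, hk⟩ := (AlmostSubset.of_subset (half_subset _ (β ∈ s))).trans
        ((towerTree_spec h s β (hβ.le.trans hγ)).2 α hα)
      refine le_iSup_of_le k (le_iInf₂ fun j hkj => le_himp_of fun Θ hΘ hj => ?_)
      by_cases hjβ : j ∈ T s β
      · exact hD s α j Θ ((hΘ.trans hs).trans (e_mono s α β hα.le)) (hk j hkj hjβ)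
      · exact (hD' s β j Θ (hΘ.trans hs) hjβ hj).trans bot_le

/-! ### Adaptively chosen decisions -/

section Decisions

variable {B L : Type*} [CompleteBooleanAlgebra B]

/-- The condition reached from `p` after `β` steps, when at each step `γ` the membership in the
`B`-valued set `A` of the point selected by the current condition is decided according to
`γ ∈ S`. -/
noncomputable def decided (A : L → B) (p : B) (pick : B → L) (S : Set Ordinal.{u})
    (β : Ordinal.{u}) : B :=
  p ⊓ ⨅ γ : Set.Iio β, lit (A (pick (decided A p pick S γ.1))) (γ.1 ∈ S)
termination_by β
decreasing_by exact γ.2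

variable {A : L → B} {p : B} {pick : B → L} {S T : Set Ordinal.{u}}

theorem le_decided_iff {Γ : B} {β : Ordinal.{u}} : Γ ≤ decided A p pick S β ↔
    Γ ≤ p ∧ ∀ γ < β, Γ ≤ lit (A (pick (decided A p pick S γ))) (γ ∈ S) := by
  rw [decided, le_inf_iff, le_iInf_iff]
  simp

theorem decided_congr (β : Ordinal.{u}) (h : ∀ δ < β, (δ ∈ S ↔ δ ∈ T)) :
    decided A p pick S β = decided A p pick T β := by
  induction β using WellFoundedLT.induction with
  | ind β ih =>
    rw [decided, decided]
    congr 2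
    funext γ
    rw [ih γ.1 γ.2 fun δ hδ => h δ (hδ.trans γ.2), propext (h γ.1 γ.2)]

/-- Up to the least disagreement of `S` and `T` the conditions coincide, so the same point is picked
there and receives opposite answers. -/
theorem decided_conflict {Γ : B} {β : Ordinal.{u}} (hS : Γ ≤ decided A p pick S β)
    (hT : Γ ≤ decided A p pick T β) (h : ¬∀ δ < β, (δ ∈ S ↔ δ ∈ T)) : Γ ≤ ⊥ := by
  by_contra hΓ
  refine h fun δ => ?_
  induction δ using WellFoundedLT.induction with
  | ind δ ih =>
    intro hδ
    by_contra hne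
    have hS' := (le_decided_iff.1 hS).2 δ hδ
    rw [decided_congr δ fun ε hε => ih ε hε (hε.trans hδ)] at hS'
    exact hΓ (lit_conflict hS' ((le_decided_iff.1 hT).2 δ hδ) hne)

theorem NoNewSubsets.exists_decided_ne_bot {κ : Ordinal.{u}} (hB : NoNewSubsets B κ)
    (hp : p ≠ ⊥) (pick : B → L) : ∃ S : Set Ordinal.{u}, decided A p pick S κ ≠ ⊥ := by
  by_contra hall
  push Not at hall
  refine hp (le_bot_iff.1 ?_)
  -- The generic branch: the `B`-valued set of steps at which the point picked turns out to lie in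
  -- `A`. Any `S` equal to it keeps all its conditions true.
  let b : Ordinal.{u} → B := fun β =>
    ⨆ S, decided A p pick S β ⊓ A (pick (decided A p pick S β))
  refine le_of_le_iSup (le_top.trans (hB b).ge) fun S Γ hΓ hS => (hall S) ▸ ?_
  suffices ∀ β ≤ κ, Γ ≤ decided A p pick S β from this κ le_rfl
  intro β
  induction β using WellFoundedLT.induction with
  | ind β ih =>
    intro hβ
    refine le_decided_iff.2 ⟨hΓ, fun γ hγ => ?_⟩
    have hq := ih γ hγ (hγ.le.trans hβ)
    have hb := hS.trans (iInf_le_of_le γ (iInf_le _ (hγ.trans_le hβ)))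
    by_cases hγS : γ ∈ S
    · rw [lit_of_true hγS] at hb ⊢
      refine le_of_le_iSup hb fun T Δ hΔ hT => ?_
      by_cases hST : ∀ δ < γ, (δ ∈ S ↔ δ ∈ T)
      · rw [decided_congr γ hST]
        exact hT.trans inf_le_right
      · exact (decided_conflict (hΔ.trans hq) (hT.trans inf_le_left) hST).trans bot_le
    · rw [lit_of_false hγS] at hb ⊢
      exact le_compl_of fun Δ hΔ hA => le_bot_of_le_compl (hΔ.trans hb)
        (le_iSup_of_le S (le_inf (hΔ.trans hq) hA))

/-- If functions `X → κ` of the extension are bounded by functions of the ground model, where `X`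
is the set of `κ`-sequences of literals, then a set of the extension belongs to the ground model
once all subsets of `κ` do. -/
theorem NoNewSubsets.iSup_iInf_lit_eq_top {κ : Ordinal.{u}} [Nonempty κ.ToType] (hB : NoNewSubsets B κ)
    (hweak : ∀ a : (κ.ToType → L × Prop) → κ.ToType → B, (∀ x, ⨆ β, a x β = ⊤) →
      ⨆ g : (κ.ToType → L × Prop) → κ.ToType, ⨅ x, ⨆ β, ⨆ _ : β < g x, a x β = ⊤)
    (A : L → B) : ⨆ s : Set L, ⨅ l, lit (A l) (l ∈ s) = ⊤ := by
  by_contra hne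
  set v := ⨆ s : Set L, ⨅ l, lit (A l) (l ∈ s) with hv
  have hu : vᶜ ≠ ⊥ := fun h => hne (compl_eq_bot.1 h)
  -- A nonzero condition deciding every point would make `A` an old set, so it could not lie below
  -- `vᶜ`.
  have undecided : ∀ q : B, ∃ l, q ≤ vᶜ → q ≠ ⊥ → ∀ P, ¬q ≤ lit (A l) P := by
    intro q
    by_contra hall
    push Not at hall
    by_cases hL : Nonempty L
    · obtain ⟨hqv, hq, -⟩ := hall hL.some
      choose _ _ P hP using hall
      refine hq (le_bot_iff.1 (le_bot_of_le_compl hqv ?_))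
      exact le_iSup_of_le {l | P l} (le_iInf fun l => hP l)
    · rw [not_nonempty_iff] at hL
      exact hne (by simp [hv])
  choose pick hpick using undecided
  -- "Literal `β` of `x` fails, or all literals of `x` hold": by excluded middle this is true for
  -- some `β`.
  let a : (κ.ToType → L × Prop) → κ.ToType → B := fun x β =>
    (lit (A (x β).1) (x β).2)ᶜ ⊔ ⨅ γ, lit (A (x γ).1) (x γ).2
  have ha : ∀ x, ⨆ β, a x β = ⊤ := by
    intro x
    simp only [a]
    rw [← iSup_sup, ← compl_iInf, compl_sup_eq_top]
  obtain ⟨g, hg⟩ : ∃ g : (κ.ToType → L × Prop) → κ.ToType,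
      vᶜ ⊓ ⨅ x, ⨆ β, ⨆ _ : β < g x, a x β ≠ ⊥ := by
    by_contra hall
    push Not at hall
    exact hu (le_bot_iff.1 (le_of_le_iSup (le_top.trans (hweak a ha).ge) fun g Δ hΔ h =>
      hall g ▸ le_inf hΔ h))
  set p := vᶜ ⊓ ⨅ x, ⨆ β, ⨆ _ : β < g x, a x β
  obtain ⟨S, hS⟩ := hB.exists_decided_ne_bot (A := A) hg pick
  let x : κ.ToType → L × Prop := fun β =>
    (pick (decided A p pick S β.toOrd), (β.toOrd : Ordinal) ∈ S)
  -- All literals of `x` before `g x` hold at `q`, so `q` forces the whole of `x`. Its literal at `g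
  -- x` concerns exactly `pick q`, which `q` must leave undecided.
  let q := decided A p pick S (g x).toOrd
  have hq := le_decided_iff.1 (le_refl q)
  have hqS : q ≠ ⊥ := fun h => hS <| le_bot_iff.1 <| h ▸ le_decided_iff.2
    ⟨(le_decided_iff.1 le_rfl).1, fun γ hγ =>
      (le_decided_iff.1 le_rfl).2 γ (hγ.trans (g x).toOrd.2)⟩
  refine hpick q (hq.1.trans inf_le_left) hqS ((g x).toOrd.1 ∈ S) ?_
  refine le_of_le_iSup (hq.1.trans (inf_le_right.trans (iInf_le _ x))) fun β Δ hΔ h =>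
    le_of_le_iSup h fun hβ Δ' hΔ' h => le_of_le_sup h (fun Θ hΘ h => ?_) fun Θ _ h => ?_
  · refine (le_bot_of_le_compl h ?_).trans bot_le
    exact (hΘ.trans (hΔ'.trans hΔ)).trans (hq.2 β.toOrd (by simpa using hβ))
  · exact h.trans (iInf_le _ (g x))

theorem iSup_iInf_lit_eq_top_of_subsingleton [Subsingleton L] (A : L → B) :
    ⨆ s : Set L, ⨅ l, lit (A l) (l ∈ s) = ⊤ := by
  rcases isEmpty_or_nonempty L with hL | ⟨⟨l⟩⟩
  · simp
  · have h : (⊤ : B) ≤ A l ⊔ (A l)ᶜ := by simp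
    refine top_le_iff.1 (le_of_le_sup h (fun Δ _ h => le_iSup_of_le Set.univ ?_)
      fun Δ _ h => le_iSup_of_le ∅ ?_)
    · exact le_iInf fun l' => by rwa [Subsingleton.elim l' l, lit_of_true (Set.mem_univ l)]
    · exact le_iInf fun l' => by rwa [Subsingleton.elim l' l, lit_of_false (Set.notMem_empty l)]

end Decisions

/-! ### Distributivity laws -/

variable {B : Type u} [CompleteBooleanAlgebra B]

theorem noNewReals_of_isDistributiveBA {ν : Ordinal.{u}} (hν : 2 ≤ ν)
    (h : IsDistributiveBA B Ordinal.omega0 ν) : NoNewReals B := by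
  intro b
  obtain ⟨i, j, hij⟩ : ∃ i j : ν.ToType, i ≠ j := by
    rw [← Cardinal.two_le_iff, Cardinal.mk_toType]
    simpa using Ordinal.card_le_card hν
  choose n hn using fun a : Ordinal.omega0.{u}.ToType =>
    Ordinal.lt_omega0.1 (Set.mem_Iio.1 a.toOrd.2)
  -- Index `i` stands for "yes" and every other index for "no"; `j` guarantees that "no" occurs.
  have key := h fun a k => lit (b (n a)) (k = i)
  have htop : ⨅ a, ⨆ k, lit (b (n a)) (k = i) = ⊤ := by
    refine iInf_eq_top.2 fun a => top_le_iff.1 ?_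
    have h : (⊤ : B) ≤ b (n a) ⊔ (b (n a))ᶜ := by simp
    refine le_of_le_sup h (fun Δ _ h => le_iSup_of_le i ?_) fun Δ _ h => le_iSup_of_le j ?_
    · rwa [lit_of_true rfl]
    · rwa [lit_of_false hij.symm]
  refine top_le_iff.1 (le_of_le_iSup (htop.symm.trans key).le fun f Δ _ hf => ?_)
  let m : ℕ → Ordinal.omega0.{u}.ToType := fun k =>
    Ordinal.ToType.mk ⟨k, Ordinal.natCast_lt_omega0 k⟩
  have hm : ∀ k, n (m k) = k := fun k => by
    have := hn (m k)
    simp only [m, OrderIso.symm_apply_apply] at this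
    exact_mod_cast this.symm
  refine le_iSup_of_le {k | f (m k) = i} (le_iInf fun k => ?_)
  have := hf.trans (iInf_le _ (m k))
  rwa [hm] at this

theorem isDistributiveBA_two_of {μ : Ordinal.{u}}
    (h : ∀ b : μ.ToType → B, ⨆ s : Set μ.ToType, ⨅ α, lit (b α) (α ∈ s) = ⊤) :
    IsDistributiveBA B μ 2 := by
  classical
  intro a
  obtain ⟨i, j, -, hij⟩ : ∃ i j : (2 : Ordinal.{u}).ToType, i ≠ j ∧ {i, j} = Set.univ := by
    rw [← Cardinal.mk_eq_two_iff, Cardinal.mk_toType]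
    simp
  refine le_antisymm ?_ (iSup_le fun f => le_iInf fun α => (iInf_le _ α).trans (le_iSup _ (f α)))
  refine le_of_le_iSup (le_top.trans (h fun α => a α i).ge) fun s Δ hΔ hs => ?_
  refine le_iSup_of_le (fun α => if α ∈ s then i else j) (le_iInf fun α => ?_)
  have hα := hs.trans (iInf_le _ α)
  by_cases hαs : α ∈ s
  · simp only [if_pos hαs]
    rwa [lit_of_true hαs] at hα
  · simp only [if_neg hαs]
    rw [lit_of_false hαs] at hα
    refine le_of_le_iSup (hΔ.trans (iInf_le _ α)) fun k Θ hΘ hk => ?_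
    rcases (hij ▸ Set.mem_univ k : k ∈ ({i, j} : Set _)) with rfl | rfl
    · exact (le_bot_of_le_compl (hΘ.trans hα) hk).trans bot_le
    · exact hk

theorem IsWeaklyDistributiveBA.iSup_eq_top {X : Type u} [Nonempty X] {μ ν : Ordinal.{u}}
    (h : IsWeaklyDistributiveBA B μ ν) (hX : Cardinal.mk X ≤ μ.card) (a : X → ν.ToType → B)
    (ha : ∀ x, ⨆ β, a x β = ⊤) : ⨆ g : X → ν.ToType, ⨅ x, ⨆ β, ⨆ _ : β < g x, a x β = ⊤ := by
  rw [← Cardinal.mk_toType] at hX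
  obtain ⟨e⟩ := hX
  -- The family is reindexed along a left inverse of an injection of `X`; repeated terms do no harm,
  -- since all joins are `⊤`.
  have key := h fun m => a (Function.invFun e m)
  simp only [ha, iInf_top] at key
  refine top_le_iff.1 (le_of_le_iSup key.le fun g Δ _ hg => ?_)
  refine le_iSup_of_le (fun x => g (e x)) (le_iInf fun x => ?_)
  have := hg.trans (iInf_le _ (e x))
  rwa [Function.leftInverse_invFun e.injective] at this

/-- The truth values cost a factor 2^κ, absorbed by λ^κ because λ ≥ 2 and κ is infinite. -/
theorem mk_sequences_le {κ lam : Ordinal.{u}} (hκ : Ordinal.omega0 ≤ κ) (hlam : 2 ≤ lam) :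
    Cardinal.mk (κ.ToType → lam.ToType × Prop) ≤ (lam.card ^ κ.card).ord.card := by
  have hκ' : Cardinal.aleph0 ≤ κ.card := by simpa using Ordinal.card_le_card hκ
  have hlam' : 2 ≤ lam.card := by simpa using Ordinal.card_le_card hlam
  rw [Cardinal.card_ord, ← Cardinal.power_def, Cardinal.mk_prod, Cardinal.mk_toType,
    Cardinal.mk_toType, Cardinal.mk_Prop, Cardinal.lift_id', Cardinal.lift_ofNat,
    Cardinal.mul_power]
  calc lam.card ^ κ.card * 2 ^ κ.card ≤ lam.card ^ κ.card * lam.card ^ κ.card := by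
        gcongr
        exact Cardinal.power_le_power_right hlam'
    _ = lam.card ^ κ.card := by rw [← Cardinal.power_add, Cardinal.add_eq_self hκ']

end BooleanForcing

theorem mainTheorem5 {B : Type u} [CompleteBooleanAlgebra B] (κ lam : Ordinal.{u})
    (hκ : Ordinal.omega0 ≤ κ)
    (hκt : BName.Forced (BName.ltTowerNumber (BName.ordName κ : BName B)))
    (hlam : BName.Forced (BName.leContinuum (BName.ordName lam : BName B)))
    (hdist : IsDistributiveBA B Ordinal.omega0 lam)
    (hweak : IsWeaklyDistributiveBA B (lam.card ^ κ.card).ord κ) :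
    IsDistributiveBA B lam 2 := by
  refine isDistributiveBA_two_of fun A => ?_
  rcases subsingleton_or_nontrivial B with hB | hB
  · exact Subsingleton.elim _ _
  -- For λ < 2 distributivity says nothing about reals, but a subset of at most one point is decided
  -- by excluded middle.
  rcases lt_or_ge lam 2 with hlt | hge
  · have : Subsingleton lam.ToType := by
      rw [← Cardinal.le_one_iff_subsingleton, Cardinal.mk_toType]
      have : lam ≤ 1 := by rwa [← Order.lt_add_one_iff, one_add_one_eq_two]
      simpa using Ordinal.card_le_card this
    exact iSup_iInf_lit_eq_top_of_subsingleton A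
  · have : Nonempty (κ.ToType → lam.ToType × Prop) := by
      have : Nonempty lam.ToType := Ordinal.nonempty_toType_iff.2 (by rintro rfl; simp at hge)
      infer_instance
    have : Nonempty κ.ToType :=
      Ordinal.nonempty_toType_iff.2 (Ordinal.omega0_pos.trans_le hκ).ne'
    have hreals := noNewReals_of_isDistributiveBA hge hdist
    have hsub : NoNewSubsets B κ := noNewSubsets_of_hasPseudoIntersections
      (fun γ hγ => BName.hasPseudoIntersections_of_ltTowerNumber hreals hκt hγ) κ le_rfl
    exact hsub.iSup_iInf_lit_eq_top (hweak.iSup_eq_top (mk_sequences_le hκ hge)) A
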